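/- Let $n\ge 1$, let $S^n\subset\mathbb R^{n+1}$ be the unit sphere with its angular metric $d(x,y)=\arccos\langle x,y\rangle$, and let $\Omega\subset S^n$ be open and convex (that is, $\Omega$ is contained in an open hemisphere and any two points of $\Omega$ are joined by a geodesic contained in $\Omega$), with diameter less than $\pi/2$ with respect to $d$. For $x\neq y$ in $\Omega$ let $\xi_{xy}$ be the unit tangent vector at $x$ of the arc-length parametrized minimizing geodesic from $x$ to $y$, and let $b(x,y)$ be the first point at which the geodesic ray $\{\exp_x(t\xi_{xy}) : t>0\}$ meets $\partial\Omega$. The spherical Funk metric of $\Omega$ is $$F(x,y)=\log\frac{\sin d(x,b(x,y))}{\sin d(y,b(x,y))}\quad (x\ne y),\qquad F(x,x)=0 .$$ Let $\mathcal P$ be the set of supporting hyperplanes of $\Omega$, i.e. of great hyperspheres $\pi$ of $S^n$ that contain a point of $\partial\Omega$ and bound an open hemisphere containing $\Omega$. For $x\in\Omega$ and $\pi\in\mathcal P$ let $d(x,\pi)$ be the distance from $x$ to $\pi$ and $\eta_\pi(x)$ the unit tangent vector at $x$ opposite in direction to the gradient of $d(\cdot,\pi)$ at $x$; for $\xi\in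 T_xS^n$, $\xi\ne0$, let $T(x,\xi,\pi)$ be the first point of $\pi$ on the ray $\{\exp_x(t\xi): t>0\}$. For $x\in\Omega$ and $\xi\in T_xS^n$ put $$p^{(1)}_{\Omega,x}(\xi)=\sup_{\pi\in\mathcal P}\frac{\cos d(x,T(x,\xi,\pi))}{\sin d(x,T(x,\xi,\pi))}\,\|\xi\|,\qquad p^{(2)}_{\Omega,x}(\xi)=\sup_{\pi\in\mathcal P}\frac{\cos d(x,\pi)}{\sin d(x,\pi)}\,\langle\eta_\pi(x),\xi\rangle ,$$ where the terms of the first supremum are $0$ for $\xi=0$. Then the points $b(x,y)$ and $T(x,\xi,\pi)$ exist, $\mathcal P\neq\emptyset$ if $\Omega\ne\emptyset$, both suprema are finite, and $p^{(1)}_{\Omega,x}=p^{(2)}_{\Omega,x}=:p_{\Omega,x}$ is a weak norm on $T_xS^n$ (it is convex and vanishes at $0$). For every piecewise $C^1$ curve $\gamma:[a,b]\to\Omega$ the function $t\mapsto p_{\Omega,\gamma(t)}(\gamma'(t))$ is integrable on $[a,b]$, and for all $x,y\in\Omega$ $$\inf_\gamma\int_a^b p_{\Omega,\gamma(t)}(\gamma'(t))\,dt=F(x,y),$$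 where the infimum is over all piecewise $C^1$ curves $\gamma$ in $\Omega$ from $x$ to $y$: the Finsler distance induced by $p_{\Omega,x}$, in either of its two forms, is the spherical Funk metric. -/

import Mathlib

open scoped RealInnerProductSpace

noncomputable section

namespace SphFunk

/-- The Euclidean space `ℝⁿ⁺¹` in which the sphere `Sⁿ` sits. -/
abbrev Amb (n : ℕ) : Type := EuclideanSpace ℝ (Fin (n + 1))

/-- The unit sphere `Sⁿ ⊆ ℝⁿ⁺¹`. -/
abbrev Sph (n : ℕ) : Type := Metric.sphere (0 : Amb n) 1

variable {n : ℕ}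

/-- The tangent space of the sphere at `x`, the orthogonal complement of `x`. -/
def tangent (x : Sph n) : Submodule ℝ (Amb n) := (ℝ ∙ (x : Amb n))ᗮ

/-- The angular metric of the unit sphere (for points of the sphere, `arccos ⟪x, y⟫`). -/
def sdist (x y : Amb n) : ℝ := InnerProductGeometry.angle x y

/-- The exponential map of the unit sphere: for a tangent vector `v` at `x`,
`cos ‖v‖ • x + (sin ‖v‖ / ‖v‖) • v`. The geodesic issued from `x` with velocity `v` is
`t ↦ sphExp x (t • v)`. -/
def sphExp (x : Sph n) (v : Amb n) : Amb n :=
  Real.cos ‖v‖ • (x : Amb n) + Real.sinc ‖v‖ • v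

/-- A convex subset of the sphere: it is contained in an open half-space (open hemisphere), and
any two of its points are connected by a geodesic contained in it. -/
def SphConvex (Ω : Set (Sph n)) : Prop :=
  (∃ u : Amb n, ‖u‖ = 1 ∧ ∀ z ∈ Ω, 0 < ⟪u, (z : Amb n)⟫) ∧
  ∀ x ∈ Ω, ∀ y ∈ Ω, ∃ v ∈ tangent x, sphExp x v = y ∧
    ∀ t ∈ Set.Icc (0 : ℝ) 1, ∃ z ∈ Ω, (z : Amb n) = sphExp x (t • v)

/-- The diameter of `Ω` for the angular metric is smaller than `π / 2`. -/
def DiamLtPiDivTwo (Ω : Set (Sph n)) : Prop :=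
  ∃ D : ℝ, D < Real.pi / 2 ∧ ∀ x ∈ Ω, ∀ y ∈ Ω, sdist (x : Amb n) y ≤ D

/-- The first point of `A` on the geodesic ray `{sphExp x (t • ξ) | t > 0}`. -/
def firstPoint (A : Set (Sph n)) (x : Sph n) (ξ : Amb n) : Amb n :=
  sphExp x (sInf {t : ℝ | 0 < t ∧ ∃ z ∈ A, (z : Amb n) = sphExp x (t • ξ)} • ξ)

/-- The unit tangent vector at `x` of the arc-length parametrized minimizing geodesic from `x`
to `y` (for `y ≠ x`, `y ≠ -x`). -/
def dir (x y : Sph n) : Amb n :=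
  ‖(y : Amb n) - ⟪(x : Amb n), (y : Amb n)⟫ • (x : Amb n)‖⁻¹ •
    ((y : Amb n) - ⟪(x : Amb n), (y : Amb n)⟫ • (x : Amb n))

/-- The point `b(x, y)` where the geodesic ray from `x` through `y` first meets the boundary. -/
def bdryPoint (Ω : Set (Sph n)) (x y : Sph n) : Amb n :=
  firstPoint (frontier Ω) x (dir x y)

open Classical in
/-- The spherical Funk metric. -/
def funk (Ω : Set (Sph n)) (x y : Sph n) : ℝ :=
  if x = y then 0
  else Real.log (Real.sin (sdist (x : Amb n) (bdryPoint Ω x y)) /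
    Real.sin (sdist (y : Amb n) (bdryPoint Ω x y)))

/-- The great hypersphere (hyperplane of `Sⁿ`) orthogonal to `u`. -/
def hyperplane (u : Amb n) : Set (Sph n) := {z | ⟪u, (z : Amb n)⟫ = 0}

/-- The supporting hyperplanes of `Ω`: hyperplanes through a boundary point of `Ω` that bound an
open half-space containing `Ω`. -/
def supporting (Ω : Set (Sph n)) : Set (Set (Sph n)) :=
  {P | ∃ u : Amb n, ‖u‖ = 1 ∧ P = hyperplane u ∧ (∀ z ∈ Ω, 0 < ⟪u, (z : Amb n)⟫) ∧
    ∃ b ∈ frontier Ω, b ∈ P}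

/-- The angular distance from a point to a set. -/
def distTo (P : Set (Sph n)) (z : Amb n) : ℝ := ⨅ q : P, sdist z ((q : Sph n) : Amb n)

/-- The Riemannian gradient at `x` of a function on the sphere, as the Euclidean gradient of its
extension that is constant on rays from the origin. -/
def sphGrad (f : Amb n → ℝ) (x : Sph n) : Amb n :=
  gradient (fun z : Amb n => f (‖z‖⁻¹ • z)) (x : Amb n)

/-- `η_P(x)`: the unit tangent vector at `x` opposite to the gradient of the distance to `P`. -/
def eta (P : Set (Sph n)) (x : Sph n) : Amb n :=
  -(‖sphGrad (distTo P) x‖⁻¹ • sphGrad (distTo P) x)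

/-- The term `cot d(x, T(x, ξ, P)) ‖ξ‖`, where `T(x, ξ, P)` is the first point of `P` on the
geodesic ray issued from `x` in direction `ξ` (it vanishes for `ξ = 0`). -/
def term₁ (P : Set (Sph n)) (x : Sph n) (ξ : Amb n) : ℝ :=
  Real.cos (sdist (x : Amb n) (firstPoint P x ξ)) /
    Real.sin (sdist (x : Amb n) (firstPoint P x ξ)) * ‖ξ‖

/-- The term `cot d(x, P) ⟪η_P(x), ξ⟫`. -/
def term₂ (P : Set (Sph n)) (x : Sph n) (ξ : Amb n) : ℝ :=
  Real.cos (distTo P (x : Amb n)) / Real.sin (distTo P (x : Amb n)) * ⟪eta P x, ξ⟫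

/-- The Minkowski functional in terms of the points where the ray meets the hyperplanes. -/
def mink₁ (Ω : Set (Sph n)) (x : Sph n) (ξ : Amb n) : ℝ :=
  ⨆ P : supporting Ω, term₁ (P : Set (Sph n)) x ξ

/-- The Minkowski functional in terms of the distances to the hyperplanes. -/
def mink₂ (Ω : Set (Sph n)) (x : Sph n) (ξ : Amb n) : ℝ :=
  ⨆ P : supporting Ω, term₂ (P : Set (Sph n)) x ξ

/-- `γ` is piecewise `C¹` on `[a, b]`: it is continuous there and, for some finite set `s` of
break points, it is `C¹` on each closed subinterval whose interior avoids `s`. -/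
def PiecewiseC1 (γ : ℝ → Amb n) (a b : ℝ) : Prop :=
  ContinuousOn γ (Set.Icc a b) ∧ ∃ s : Finset ℝ, ∀ c ∈ Set.Icc a b, ∀ d ∈ Set.Icc a b, c < d →
    (∀ t ∈ s, t ∉ Set.Ioo c d) → ContDiffOn ℝ 1 γ (Set.Icc c d)

/-- `γ` is a piecewise `C¹` curve in `Ω`, parametrized by `[a, b]`, from `x` to `y`. -/
structure IsCurve (Ω : Set (Sph n)) (γ : ℝ → Sph n) (a b : ℝ) (x y : Sph n) : Prop where
  lt : a < b
  left : γ a = x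
  right : γ b = y
  mem : ∀ t ∈ Set.Icc a b, γ t ∈ Ω
  piecewise : PiecewiseC1 (fun t => (γ t : Amb n)) a b

/-- The integrand `t ↦ p_{γ(t)}(γ'(t))` of the length of `γ`. -/
def speed (p : Sph n → Amb n → ℝ) (γ : ℝ → Sph n) (t : ℝ) : ℝ :=
  p (γ t) (deriv (fun s => (γ s : Amb n)) t)

/-- The set of `p`-lengths of the piecewise `C¹` curves in `Ω` from `x` to `y`. The Finsler
distance induced by `p` is its greatest lower bound. -/
def lengths (p : Sph n → Amb n → ℝ) (Ω : Set (Sph n)) (x y : Sph n) : Set ℝ :=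
  {L | ∃ (γ : ℝ → Sph n) (a b : ℝ), IsCurve Ω γ a b x y ∧ L = ∫ t in a..b, speed p γ t}

end SphFunk

end

open SphFunk

/-! Everything becomes linear in the ambient space. A supporting hyperplane is orthogonal to a unit
vector u that is positive on Ω and vanishes at some boundary point. On tangent vectors both terms
equal `-⟪u, ξ⟫ / ⟪u, x⟫`. For the first, `⟪u, ·⟫` along a unit-speed ray is proportional to sin(τ -
σ), with τ the hitting time, so this ratio is ‖ξ‖ cot τ. For the second, the distance to the
hyperplane is arcsin ⟪u, ·⟫, whose gradient is explicit; this needs ⟪u, x⟫ < 1, which the diameter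
bound provides. Both suprema are therefore `coneNorm`, a supremum of linear functionals.

Lower bound: along a curve, `-⟪u, γ'⟫ / ⟪u, γ⟫` is the derivative of -log ⟪u, γ⟫, so every length is
at least log (⟪u, x⟫ / ⟪u, y⟫), for every support vector u (`IsCurve.log_le_integral`). The cone
over Ω is open and convex, so Hahn-Banach gives a support vector u vanishing at b(x, y)
(`exists_supportVector`). For this u the bound is exactly F(x, y) (`funk_eq_log`).

Attainment: along the geodesic from x to y the same u realizes the supremum at every time, with
value cot of the remaining distance to b(x, y) (`coneNorm_geod`). Integrating the cotangent gives
F(x, y), so the infimum is a minimum. -/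

noncomputable section

namespace SphFunk

variable {n : ℕ}

/-! ### Great circles and basic notions -/

/-- The great circle through `x` with unit initial velocity `θ`. -/
def geod (x θ : Amb n) (τ : ℝ) : Amb n := Real.cos τ • x + Real.sin τ • θ

/-- The unit vectors orthogonal to the supporting hyperplanes and positive on `Ω`. -/
def supportVectors (Ω : Set (Sph n)) : Set (Amb n) :=
  {u | ‖u‖ = 1 ∧ (∀ z ∈ Ω, 0 < ⟪u, (z : Amb n)⟫) ∧ ∃ b ∈ frontier Ω, ⟪u, (b : Amb n)⟫ = 0}

/-- The open cone over a subset of the sphere. -/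
def coneOver (Ω : Set (Sph n)) : Set (Amb n) :=
  {w | ∃ t : ℝ, 0 < t ∧ ∃ z ∈ Ω, w = t • (z : Amb n)}

/-- The supremum of the linear functionals `-⟪u, ξ⟫ / ⟪u, x⟫` over the support vectors. -/
def coneNorm (Ω : Set (Sph n)) (x ξ : Amb n) : ℝ :=
  ⨆ u : supportVectors Ω, -⟪(u : Amb n), ξ⟫ / ⟪(u : Amb n), x⟫

lemma norm_coe_sph (x : Sph n) : ‖(x : Amb n)‖ = 1 := mem_sphere_zero_iff_norm.1 x.2

lemma inner_self_sph (x : Sph n) : ⟪(x : Amb n), (x : Amb n)⟫ = 1 := by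
  rw [real_inner_self_eq_norm_sq, norm_coe_sph]; norm_num

lemma mem_tangent_iff {x : Sph n} {ξ : Amb n} : ξ ∈ tangent x ↔ ⟪(x : Amb n), ξ⟫ = 0 :=
  Submodule.mem_orthogonal_singleton_iff_inner_right

lemma inner_geod_geod {x θ : Amb n} (hx : ‖x‖ = 1) (hθ : ‖θ‖ = 1) (h : ⟪x, θ⟫ = 0) (σ τ : ℝ) :
    ⟪geod x θ σ, geod x θ τ⟫ = Real.cos (τ - σ) := by
  have h' : ⟪θ, x⟫ = 0 := by rw [real_inner_comm]; exact h
  simp only [geod, inner_add_left, inner_add_right, inner_smul_left, inner_smul_right, h, h',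
    real_inner_self_eq_norm_sq, hx, hθ, Real.cos_sub]
  simp

lemma norm_geod {x θ : Amb n} (hx : ‖x‖ = 1) (hθ : ‖θ‖ = 1) (h : ⟪x, θ⟫ = 0) (τ : ℝ) :
    ‖geod x θ τ‖ = 1 := by
  have h1 := inner_geod_geod hx hθ h τ τ
  rw [real_inner_self_eq_norm_sq, sub_self, Real.cos_zero] at h1
  exact (pow_eq_one_iff_of_nonneg (norm_nonneg _) two_ne_zero).1 h1

lemma sdist_eq_arccos {x y : Amb n} (hx : ‖x‖ = 1) (hy : ‖y‖ = 1) :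
    sdist x y = Real.arccos ⟪x, y⟫ := by
  simp [sdist, InnerProductGeometry.angle, hx, hy]

lemma sdist_geod {x θ : Amb n} (hx : ‖x‖ = 1) (hθ : ‖θ‖ = 1) (h : ⟪x, θ⟫ = 0) {σ τ : ℝ}
    (h1 : σ ≤ τ) (h2 : τ - σ ≤ Real.pi) : sdist (geod x θ σ) (geod x θ τ) = τ - σ := by
  rw [sdist_eq_arccos (norm_geod hx hθ h σ) (norm_geod hx hθ h τ), inner_geod_geod hx hθ h,
    Real.arccos_cos (by linarith) h2]

@[simp] lemma geod_zero (x θ : Amb n) : geod x θ 0 = x := by simp [geod]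

lemma inner_geod (u x θ : Amb n) (τ : ℝ) :
    ⟪u, geod x θ τ⟫ = Real.cos τ * ⟪u, x⟫ + Real.sin τ * ⟪u, θ⟫ := by
  simp [geod, inner_add_right, inner_smul_right]

lemma continuous_geod (x θ : Amb n) : Continuous (geod x θ) := by
  unfold geod; fun_prop

lemma hasDerivAt_geod (x θ : Amb n) (τ : ℝ) :
    HasDerivAt (geod x θ) (Real.cos τ • θ - Real.sin τ • x) τ := by
  have := ((Real.hasDerivAt_cos τ).smul_const x).add ((Real.hasDerivAt_sin τ).smul_const θ)
  exact this.congr_deriv (by rw [neg_smul]; abel)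

/-- The spherical substitute for affine interpolation: for 0 < σ < d < π both coefficients are
positive, so points of an arc are conic combinations of its ends. -/
lemma sin_smul_geod (x θ : Amb n) (d σ : ℝ) :
    Real.sin d • geod x θ σ = Real.sin (d - σ) • x + Real.sin σ • geod x θ d := by
  simp only [geod, Real.sin_sub, smul_add, smul_smul, sub_smul]
  module

lemma sphExp_smul (x : Sph n) {θ : Amb n} (hθ : ‖θ‖ = 1) {τ : ℝ} :
    sphExp x (τ • θ) = geod x θ τ := by
  unfold sphExp geod
  rw [norm_smul, hθ, mul_one, Real.norm_eq_abs, Real.cos_abs, smul_smul]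
  congr 2
  rcases eq_or_ne τ 0 with rfl | h
  · simp
  · rcases abs_choice τ with h' | h' <;> rw [h']
    · rw [Real.sinc_of_ne_zero h]; field_simp
    · rw [Real.sinc_of_ne_zero (neg_ne_zero.2 h), Real.sin_neg]; field_simp

/-! ### First points on rays and the first term -/

/-- The first point of `A` on a ray, from its arc-length parameter. -/
lemma firstPoint_eq {A : Set (Sph n)} {x : Sph n} {θ : Amb n} (hθ : ‖θ‖ = 1) {r τ : ℝ}
    (hr : 0 < r) (hτ : 0 < τ) (hA : ∃ z ∈ A, (z : Amb n) = geod x θ τ)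
    (hfirst : ∀ σ, 0 < σ → σ < τ → ¬ ∃ z ∈ A, (z : Amb n) = geod x θ σ) :
    firstPoint A x (r • θ) = geod x θ τ := by
  have hl : IsLeast {t : ℝ | 0 < t ∧ ∃ z ∈ A, (z : Amb n) = sphExp x (t • r • θ)} (τ / r) := by
    constructor
    · refine ⟨by positivity, ?_⟩
      rw [smul_smul, div_mul_cancel₀ _ hr.ne', sphExp_smul x hθ]
      exact hA
    · rintro t ⟨ht, hz⟩
      rw [smul_smul, sphExp_smul x hθ] at hz
      by_contra! hlt
      exact hfirst (t * r) (by positivity) ((lt_div_iff₀ hr).1 hlt) hz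
  rw [firstPoint, hl.csInf_eq, smul_smul, div_mul_cancel₀ _ hr.ne', sphExp_smul x hθ]

lemma exists_smul_eq {ξ : Amb n} (hξ : ξ ≠ 0) : ∃ θ : Amb n, ‖θ‖ = 1 ∧ ξ = ‖ξ‖ • θ :=
  ⟨‖ξ‖⁻¹ • ξ, norm_smul_inv_norm hξ, by
    rw [smul_smul, mul_inv_cancel₀ (norm_ne_zero_iff.2 hξ), one_smul]⟩

lemma firstPoint_hyperplane {u θ : Amb n} {x : Sph n} (hux : 0 < ⟪u, (x : Amb n)⟫)
    (hθ : ‖θ‖ = 1) (hxθ : ⟪(x : Amb n), θ⟫ = 0) {r : ℝ} (hr : 0 < r) :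
    ∃ τ, 0 < τ ∧ τ < Real.pi ∧ Real.cos τ * ⟪u, (x : Amb n)⟫ = -⟪u, θ⟫ * Real.sin τ ∧
      ⟪u, geod x θ τ⟫ = 0 ∧ firstPoint (hyperplane u) x (r • θ) = geod x θ τ := by
  set s := ⟪u, (x : Amb n)⟫ with hs
  set c := -⟪u, θ⟫ / s with hc
  have hcs : c * s = -⟪u, θ⟫ := div_mul_cancel₀ _ hux.ne'
  have h1 := Real.arctan_lt_pi_div_two c
  have h2 := Real.neg_pi_div_two_lt_arctan c
  -- This is arccot c, the branch with values in (0, π).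
  obtain ⟨τ, hτ⟩ : ∃ τ, τ = Real.pi / 2 - Real.arctan c := ⟨_, rfl⟩
  have hcos : Real.cos τ = c * Real.sin τ := by
    have := Real.tan_mul_cos (Real.cos_arctan_pos c).ne'
    rw [Real.tan_arctan] at this
    rw [hτ, Real.cos_pi_div_two_sub, Real.sin_pi_div_two_sub, this]
  have h0 : 0 < τ := by linarith
  have hpi : τ < Real.pi := by linarith
  have hinner : ⟪u, geod x θ τ⟫ = 0 := by
    rw [inner_geod, ← hs, hcos]; linear_combination Real.sin τ * hcs
  refine ⟨τ, h0, hpi, by rw [← hcs, hcos]; ring, hinner, firstPoint_eq hθ hr h0 ?_ ?_⟩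
  · exact ⟨⟨geod x θ τ, mem_sphere_zero_iff_norm.2 (norm_geod (norm_coe_sph x) hθ hxθ τ)⟩,
      hinner, rfl⟩
  · rintro σ hσ hστ ⟨z, hz, hzeq⟩
    have hz' : ⟪u, (z : Amb n)⟫ = 0 := hz
    rw [hzeq, inner_geod, ← hs] at hz'
    -- Earlier points miss the hyperplane because sin τ ⟪u, geod σ⟫ = s sin(τ - σ).
    have h3 : 0 < Real.sin (τ - σ) := Real.sin_pos_of_pos_of_lt_pi (by linarith) (by linarith)
    have h4 : s * Real.sin (τ - σ) = 0 := by
      rw [Real.sin_sub, hcos]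
      linear_combination Real.sin τ * hz' + Real.sin σ * Real.sin τ * (-hcs)
    exact (mul_pos hux h3).ne' h4

lemma sphere_mem_hyperplane {u : Amb n} {z : Sph n} :
    z ∈ hyperplane u ↔ ⟪u, (z : Amb n)⟫ = 0 := Iff.rfl

lemma term₁_hyperplane {u ξ : Amb n} {x : Sph n} (hux : 0 < ⟪u, (x : Amb n)⟫)
    (hξ : ξ ∈ tangent x) :
    term₁ (hyperplane u) x ξ = -⟪u, ξ⟫ / ⟪u, (x : Amb n)⟫ := by
  rcases eq_or_ne ξ 0 with rfl | h0
  · simp [term₁]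
  obtain ⟨θ, hθ, hξθ⟩ := exists_smul_eq h0
  have hr : 0 < ‖ξ‖ := norm_pos_iff.2 h0
  have hxθ : ⟪(x : Amb n), θ⟫ = 0 := by
    rw [mem_tangent_iff, hξθ, inner_smul_right] at hξ
    exact (mul_eq_zero.1 hξ).resolve_left hr.ne'
  obtain ⟨τ, h1, h2, h3, -, h4⟩ := firstPoint_hyperplane hux hθ hxθ hr
  have h5 : sdist (x : Amb n) (geod x θ τ) = τ := by
    have := sdist_geod (norm_coe_sph x) hθ hxθ h1.le (by linarith)
    simpa using this
  have h6 := Real.sin_pos_of_pos_of_lt_pi h1 h2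
  rw [← hξθ] at h4
  rw [term₁, h4, h5]
  have h7 : ⟪u, ξ⟫ = ‖ξ‖ * ⟪u, θ⟫ := by
    conv_lhs => rw [hξθ, inner_smul_right]
  rw [h7, div_mul_eq_mul_div, div_eq_div_iff h6.ne' hux.ne']
  linear_combination ‖ξ‖ * h3

lemma firstPoint_mem_hyperplane {u ξ : Amb n} {x : Sph n} (hux : 0 < ⟪u, (x : Amb n)⟫)
    (hξ : ξ ∈ tangent x) (h0 : ξ ≠ 0) :
    ∃ z ∈ hyperplane u, (z : Amb n) = firstPoint (hyperplane u) x ξ := by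
  obtain ⟨θ, hθ, hξθ⟩ := exists_smul_eq h0
  have hr : 0 < ‖ξ‖ := norm_pos_iff.2 h0
  have hxθ : ⟪(x : Amb n), θ⟫ = 0 := by
    rw [mem_tangent_iff, hξθ, inner_smul_right] at hξ
    exact (mul_eq_zero.1 hξ).resolve_left hr.ne'
  obtain ⟨τ, -, -, -, h3, h4⟩ := firstPoint_hyperplane hux hθ hxθ hr
  rw [← hξθ] at h4
  exact ⟨⟨geod x θ τ, mem_sphere_zero_iff_norm.2 (norm_geod (norm_coe_sph x) hθ hxθ τ)⟩,
    h3, h4.symm⟩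

/-! ### Distance to a hyperplane, its gradient and the second term -/

/-- The distance to a hyperplane. -/
lemma distTo_hyperplane {u w : Amb n} (hu : ‖u‖ = 1) (hw : ‖w‖ = 1) (h0 : 0 ≤ ⟪u, w⟫)
    (h1 : ⟪u, w⟫ < 1) : distTo (hyperplane u) w = Real.arcsin ⟪u, w⟫ := by
  set s := ⟪u, w⟫ with hs
  have huu : ⟪u, u⟫ = 1 := by rw [real_inner_self_eq_norm_sq, hu]; norm_num
  have hww : ⟪w, w⟫ = 1 := by rw [real_inner_self_eq_norm_sq, hw]; norm_num
  have hwu : ⟪w, u⟫ = s := real_inner_comm _ _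
  have hpos : 0 < 1 - s ^ 2 := by nlinarith
  have hv2 : ‖w - s • u‖ ^ 2 = 1 - s ^ 2 := by
    rw [← real_inner_self_eq_norm_sq]
    simp only [inner_sub_left, inner_sub_right, inner_smul_left, inner_smul_right, huu, hww, hwu,
      ← hs]
    simp
    ring
  have hv : ‖w - s • u‖ = √(1 - s ^ 2) := by
    rw [← hv2, Real.sqrt_sq (norm_nonneg _)]
  have hv0 : 0 < ‖w - s • u‖ := hv ▸ Real.sqrt_pos.2 hpos
  have harc : Real.arcsin s = Real.arccos (√(1 - s ^ 2)) := Real.arcsin_eq_arccos h0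
  -- The nearest point: the normalized orthogonal projection of w to the hyperplane.
  let q : Sph n := ⟨‖w - s • u‖⁻¹ • (w - s • u),
    mem_sphere_zero_iff_norm.2 (norm_smul_inv_norm (norm_pos_iff.1 hv0))⟩
  have hq : q ∈ hyperplane u := by
    rw [sphere_mem_hyperplane]
    simp [q, inner_smul_right, inner_sub_right, ← hs, hu]
  have hwq : ⟪w, (q : Amb n)⟫ = √(1 - s ^ 2) := by
    simp only [q, inner_smul_right, inner_sub_right, hww, hwu]
    rw [show 1 - s * s = ‖w - s • u‖ ^ 2 by rw [hv2]; ring, sq, ← mul_assoc,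
      inv_mul_cancel₀ hv0.ne', one_mul, hv]
  have hbdd : BddBelow (Set.range fun q : hyperplane u => sdist w ((q : Sph n) : Amb n)) :=
    ⟨0, by rintro _ ⟨q, rfl⟩; exact InnerProductGeometry.angle_nonneg _ _⟩
  refine le_antisymm ((ciInf_le hbdd ⟨q, hq⟩).trans ?_) ?_
  · rw [sdist_eq_arccos hw (norm_coe_sph q), hwq, harc]
  · have : Nonempty (hyperplane u) := ⟨⟨q, hq⟩⟩
    refine le_ciInf fun p => ?_
    rw [sdist_eq_arccos hw (norm_coe_sph p), harc]
    refine Real.arccos_le_arccos ?_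
    have hp : ⟪u, ((p : Sph n) : Amb n)⟫ = 0 := p.2
    -- Since p is orthogonal to u, w may be replaced by its projection before applying
    -- Cauchy-Schwarz.
    calc ⟪w, ((p : Sph n) : Amb n)⟫ = ⟪w - s • u, ((p : Sph n) : Amb n)⟫ := by
          rw [inner_sub_left, inner_smul_left, hp]; simp
      _ ≤ ‖w - s • u‖ * ‖((p : Sph n) : Amb n)‖ := real_inner_le_norm _ _
      _ = √(1 - s ^ 2) := by rw [norm_coe_sph, mul_one, hv]

/-- Near x the radially constant extension is arcsin(⟪u, z⟫ / ‖z‖), differentiable because its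
argument stays away from 1. -/
lemma sphGrad_distTo_hyperplane {u : Amb n} {x : Sph n} (hu : ‖u‖ = 1)
    (h0 : 0 < ⟪u, (x : Amb n)⟫) (h1 : ⟪u, (x : Amb n)⟫ < 1) :
    sphGrad (distTo (hyperplane u)) x = (√(1 - ⟪u, (x : Amb n)⟫ ^ 2))⁻¹ •
      (u - ⟪u, (x : Amb n)⟫ • (x : Amb n)) := by
  set s := ⟪u, (x : Amb n)⟫ with hs
  have hx0 : (x : Amb n) ≠ 0 := by
    rw [← norm_ne_zero_iff, norm_coe_sph]; exact one_ne_zero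
  have hcont : ContinuousAt (fun z : Amb n => ⟪u, ‖z‖⁻¹ • z⟫) (x : Amb n) := by
    have : ContinuousAt (fun z : Amb n => ‖z‖⁻¹) (x : Amb n) :=
      continuous_norm.continuousAt.inv₀ (norm_ne_zero_iff.2 hx0)
    fun_prop
  have hval : ⟪u, ‖(x : Amb n)‖⁻¹ • (x : Amb n)⟫ = s := by
    rw [norm_coe_sph]; simp [← hs]
  have heq : (fun z : Amb n => distTo (hyperplane u) (‖z‖⁻¹ • z)) =ᶠ[nhds (x : Amb n)]
      fun z => Real.arcsin (⟪u, z⟫ / ‖z‖) := by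
    have e1 : ∀ᶠ z in nhds (x : Amb n), ⟪u, ‖z‖⁻¹ • z⟫ ∈ Set.Ioo (0 : ℝ) 1 :=
      hcont.eventually_mem (by
        simp only [hval]; exact Ioo_mem_nhds h0 h1)
    filter_upwards [e1, isOpen_ne.mem_nhds hx0] with z hz hz0
    have hz1 : ‖‖z‖⁻¹ • z‖ = 1 := norm_smul_inv_norm hz0
    rw [distTo_hyperplane hu hz1 hz.1.le hz.2, inner_smul_right, div_eq_inv_mul]
  have hnorm : HasFDerivAt (fun z : Amb n => ‖z‖) (innerSL ℝ (x : Amb n)) (x : Amb n) := by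
    have h2 := (hasStrictFDerivAt_norm_sq (x : Amb n)).hasFDerivAt.sqrt
      (by rw [norm_coe_sph]; norm_num)
    simp only [Real.sqrt_sq (norm_nonneg _), norm_coe_sph] at h2
    refine h2.congr_fderiv ?_
    ext v
    simp
  have hlin : HasFDerivAt (fun z : Amb n => ⟪u, z⟫) (innerSL ℝ u) (x : Amb n) :=
    (innerSL ℝ u).hasFDerivAt
  have hquot := hlin.mul ((hasDerivAt_inv (norm_ne_zero_iff.2 hx0)).comp_hasFDerivAt (x : Amb n) hnorm)
  have hdiv : ⟪u, (x : Amb n)⟫ / ‖(x : Amb n)‖ = s := by rw [norm_coe_sph, div_one]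
  have harc := (Real.hasDerivAt_arcsin (x := ⟪u, (x : Amb n)⟫ / ‖(x : Amb n)‖)
    (by rw [hdiv]; linarith) (by rw [hdiv]; linarith)).comp_hasFDerivAt (x : Amb n) hquot
  have hgrad : HasGradientAt (fun z : Amb n => distTo (hyperplane u) (‖z‖⁻¹ • z))
      ((√(1 - s ^ 2))⁻¹ • (u - s • (x : Amb n))) (x : Amb n) := by
    rw [hasGradientAt_iff_hasFDerivAt]
    refine HasFDerivAt.congr_of_eventuallyEq (harc.congr_fderiv ?_) heq
    ext v
    rw [hdiv]
    simp [← hs]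
    ring
  exact hgrad.gradient

/-- The factor √(1 - s²) in cot(arcsin s) cancels the norm of u - s x, and the x-component pairs to
zero with tangent vectors. -/
lemma term₂_hyperplane {u ξ : Amb n} {x : Sph n} (hu : ‖u‖ = 1)
    (h0 : 0 < ⟪u, (x : Amb n)⟫) (h1 : ⟪u, (x : Amb n)⟫ < 1) (hξ : ξ ∈ tangent x) :
    term₂ (hyperplane u) x ξ = -⟪u, ξ⟫ / ⟪u, (x : Amb n)⟫ := by
  have huu : ⟪u, u⟫ = 1 := by rw [real_inner_self_eq_norm_sq, hu]; norm_num
  have hg := sphGrad_distTo_hyperplane hu h0 h1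
  have hd := distTo_hyperplane hu (norm_coe_sph x) h0.le h1
  rw [mem_tangent_iff] at hξ
  have hxu : ⟪(x : Amb n), u⟫ = ⟪u, (x : Amb n)⟫ := real_inner_comm _ _
  set s := ⟪u, (x : Amb n)⟫ with hs
  have hpos : 0 < √(1 - s ^ 2) := Real.sqrt_pos.2 (by nlinarith)
  have hn2 : ‖u - s • (x : Amb n)‖ ^ 2 = 1 - s ^ 2 := by
    rw [← real_inner_self_eq_norm_sq]
    simp only [inner_sub_left, inner_sub_right, inner_smul_left, inner_smul_right, huu,
      inner_self_sph, hxu, ← hs]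
    simp
    ring
  have hn : ‖u - s • (x : Amb n)‖ = √(1 - s ^ 2) := by
    rw [← hn2, Real.sqrt_sq (norm_nonneg _)]
  have hgn : ‖(√(1 - s ^ 2))⁻¹ • (u - s • (x : Amb n))‖ = 1 := by
    rw [norm_smul, hn, Real.norm_eq_abs, abs_of_pos (inv_pos.2 hpos), inv_mul_cancel₀ hpos.ne']
  rw [term₂, eta, hg, hgn, hd, Real.sin_arcsin (by linarith) h1.le, Real.cos_arcsin]
  simp only [inv_one, one_smul, inner_neg_left, inner_smul_left, inner_sub_left, hξ]
  simp
  field_simp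

/-! ### The cone over Ω: openness and convexity -/

lemma coneOver_eq (Ω : Set (Sph n)) {V : Set (Amb n)} (hV : Ω = Subtype.val ⁻¹' V) :
    coneOver Ω = {w | w ≠ 0} ∩ (fun w => ‖w‖⁻¹ • w) ⁻¹' V := by
  ext w
  constructor
  · rintro ⟨t, ht, z, hz, rfl⟩
    have hz0 : (z : Amb n) ≠ 0 := by
      rw [← norm_ne_zero_iff, norm_coe_sph]; exact one_ne_zero
    refine ⟨smul_ne_zero ht.ne' hz0, ?_⟩
    rw [hV] at hz
    rw [Set.mem_preimage, norm_smul, norm_coe_sph, mul_one, Real.norm_eq_abs, abs_of_pos ht,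
      smul_smul, inv_mul_cancel₀ ht.ne', one_smul]
    exact hz
  · rintro ⟨hw, hwV⟩
    have hn : ‖‖w‖⁻¹ • w‖ = 1 := norm_smul_inv_norm hw
    refine ⟨‖w‖, norm_pos_iff.2 hw, ⟨‖w‖⁻¹ • w, mem_sphere_zero_iff_norm.2 hn⟩, ?_, ?_⟩
    · rw [hV]; exact hwV
    · rw [smul_smul, mul_inv_cancel₀ (norm_ne_zero_iff.2 hw), one_smul]

lemma isOpen_coneOver {Ω : Set (Sph n)} (hΩ : IsOpen Ω) : IsOpen (coneOver Ω) := by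
  obtain ⟨V, hV, rfl⟩ := isOpen_induced_iff.1 hΩ
  rw [coneOver_eq _ rfl]
  refine ContinuousOn.isOpen_inter_preimage ?_ isOpen_ne hV
  exact (continuousOn_id.norm.inv₀ fun w hw => norm_ne_zero_iff.2 hw).smul continuousOn_id

lemma coe_mem_coneOver_iff {Ω : Set (Sph n)} {z : Sph n} : (z : Amb n) ∈ coneOver Ω ↔ z ∈ Ω := by
  constructor
  · rintro ⟨t, ht, y, hy, h⟩
    have h1 := congrArg norm h
    rw [norm_smul, norm_coe_sph, norm_coe_sph, Real.norm_eq_abs, abs_of_pos ht, mul_one] at h1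
    rw [← h1, one_smul] at h
    rwa [Subtype.ext h]
  · exact fun h => ⟨1, one_pos, z, h, (one_smul _ _).symm⟩

lemma smul_mem_coneOver {Ω : Set (Sph n)} {w : Amb n} {t : ℝ} (ht : 0 < t)
    (hw : w ∈ coneOver Ω) : t • w ∈ coneOver Ω := by
  obtain ⟨r, hr, z, hz, rfl⟩ := hw
  exact ⟨t * r, mul_pos ht hr, z, hz, smul_smul _ _ _⟩

lemma smul_mem_coneOver_iff {Ω : Set (Sph n)} {w : Amb n} {t : ℝ} (ht : 0 < t) :
    t • w ∈ coneOver Ω ↔ w ∈ coneOver Ω :=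
  ⟨fun h => by simpa [smul_smul, ht.ne'] using smul_mem_coneOver (inv_pos.2 ht) h,
    smul_mem_coneOver ht⟩

lemma inner_pos_of_mem_coneOver {Ω : Set (Sph n)} {u w : Amb n}
    (hu : ∀ z ∈ Ω, 0 < ⟪u, (z : Amb n)⟫) (hw : w ∈ coneOver Ω) : 0 < ⟪u, w⟫ := by
  obtain ⟨r, hr, z, hz, rfl⟩ := hw
  rw [inner_smul_right]
  exact mul_pos hr (hu z hz)

lemma neg_notMem_coneOver {Ω : Set (Sph n)} (hconv : SphConvex Ω) {w : Amb n}
    (hw : w ∈ coneOver Ω) : -w ∉ coneOver Ω := by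
  obtain ⟨u, -, hu⟩ := hconv.1
  intro h
  have h1 := inner_pos_of_mem_coneOver hu hw
  have h2 := inner_pos_of_mem_coneOver hu h
  rw [inner_neg_right] at h2
  linarith

lemma add_mem_coneOver {Ω : Set (Sph n)} (hconv : SphConvex Ω) {x y : Sph n} (hx : x ∈ Ω)
    (hy : y ∈ Ω) {a b : ℝ} (ha : 0 < a) (hb : 0 < b) :
    a • (x : Amb n) + b • (y : Amb n) ∈ coneOver Ω := by
  obtain ⟨v, hv, hvy, hseg⟩ := hconv.2 x hx y hy
  rcases eq_or_ne v 0 with rfl | hv0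
  · have : (y : Amb n) = x := by rw [← hvy]; simp [sphExp]
    rw [this, ← add_smul]
    exact smul_mem_coneOver (by positivity) (coe_mem_coneOver_iff.2 hx)
  obtain ⟨θ, hθ, hvθ⟩ := exists_smul_eq hv0
  set r := ‖v‖ with hr
  have hr0 : 0 < r := norm_pos_iff.2 hv0
  have hmem : ∀ t ∈ Set.Icc (0 : ℝ) 1, geod (x : Amb n) θ (t * r) ∈ coneOver Ω := by
    intro t ht
    obtain ⟨z, hz, hzeq⟩ := hseg t ht
    rw [hvθ, smul_smul, sphExp_smul x hθ] at hzeq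
    rw [← hzeq]
    exact coe_mem_coneOver_iff.2 hz
  -- A longer arc would pass through -x, which the open hemisphere excludes.
  have hrpi : r < Real.pi := by
    by_contra! hle
    have h1 := hmem (Real.pi / r) ⟨by positivity, (div_le_one hr0).2 hle⟩
    rw [div_mul_cancel₀ _ hr0.ne'] at h1
    simp only [geod, Real.cos_pi, Real.sin_pi, zero_smul, add_zero, neg_smul, one_smul] at h1
    exact neg_notMem_coneOver hconv (coe_mem_coneOver_iff.2 hx) h1
  rw [hvθ, sphExp_smul x hθ] at hvy
  have hsr : 0 < Real.sin r := Real.sin_pos_of_pos_of_lt_pi hr0 hrpi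
  -- By the intermediate value theorem some point of the arc has coefficients on x and y, as in
  -- `sin_smul_geod`, in the ratio a : b.
  obtain ⟨t, ht, hteq⟩ : ∃ t ∈ Set.Icc (0 : ℝ) 1,
      a * Real.sin (t * r) - b * Real.sin (r - t * r) = 0 := by
    have hc : ContinuousOn (fun t : ℝ => a * Real.sin (t * r) - b * Real.sin (r - t * r))
        (Set.Icc 0 1) := by fun_prop
    refine intermediate_value_Icc zero_le_one hc ⟨?_, ?_⟩
    · simp; positivity
    · simp; positivity
  have ht1 : t < 1 := by
    refine lt_of_le_of_ne ht.2 ?_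
    rintro rfl
    simp at hteq
    rcases hteq with h | h <;> linarith
  have hpos : 0 < Real.sin (r - t * r) :=
    Real.sin_pos_of_pos_of_lt_pi (by nlinarith) (by nlinarith [ht.1])
  have hkey : Real.sin (r - t * r) • (a • (x : Amb n) + b • (y : Amb n)) =
      (a * Real.sin r) • geod (x : Amb n) θ (t * r) := by
    rw [mul_smul, sin_smul_geod, hvy]
    have : a * Real.sin (t * r) = b * Real.sin (r - t * r) := by linarith
    rw [smul_add, smul_add, smul_smul, smul_smul, smul_smul, smul_smul, this, mul_comm a,
      mul_comm b]
  rw [← smul_mem_coneOver_iff hpos, hkey]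
  exact smul_mem_coneOver (by positivity) (hmem t ht)

lemma convex_coneOver {Ω : Set (Sph n)} (hconv : SphConvex Ω) : Convex ℝ (coneOver Ω) := by
  rw [convex_iff_forall_pos]
  rintro _ ⟨r, hr, x, hx, rfl⟩ _ ⟨s, hs, y, hy, rfl⟩ a b ha hb -
  rw [smul_smul, smul_smul]
  exact add_mem_coneOver hconv hx hy (mul_pos ha hr) (mul_pos hb hs)

/-! ### Supporting hyperplanes and exit points -/

lemma inner_nonneg_of_mem_frontier {Ω : Set (Sph n)} {u : Amb n}
    (hu : ∀ z ∈ Ω, 0 < ⟪u, (z : Amb n)⟫) {b : Sph n} (hb : b ∈ frontier Ω) :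
    0 ≤ ⟪u, (b : Amb n)⟫ := by
  have hcl : IsClosed {z : Sph n | 0 ≤ ⟪u, (z : Amb n)⟫} :=
    isClosed_le continuous_const (continuous_const.inner continuous_subtype_val)
  exact closure_minimal (fun z hz => (hu z hz).le) hcl (frontier_subset_closure hb)

/-- Every boundary point lies on a supporting hyperplane. -/
lemma exists_supportVector {Ω : Set (Sph n)} (hopen : IsOpen Ω) (hconv : SphConvex Ω)
    {b : Sph n} (hb : b ∈ frontier Ω) : ∃ u ∈ supportVectors Ω, ⟪u, (b : Amb n)⟫ = 0 := by
  have hbΩ : b ∉ Ω := (hopen.frontier_eq ▸ hb).2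
  have hbC : (b : Amb n) ∉ coneOver Ω := fun h => hbΩ (coe_mem_coneOver_iff.1 h)
  obtain ⟨f, hf⟩ := geometric_hahn_banach_open_point (convex_coneOver hconv)
    (isOpen_coneOver hopen) hbC
  -- The separating value is 0: the cone accumulates at the origin, and f cannot be positive on a
  -- set stable under dilation and bounded above by f b.
  have hfb : 0 ≤ f b := by
    obtain ⟨x, hx⟩ : Ω.Nonempty := closure_nonempty_iff.1 ⟨b, frontier_subset_closure hb⟩
    have hlim : Filter.Tendsto (fun t : ℝ => f (t • (x : Amb n))) (nhdsWithin 0 (Set.Ioi 0))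
        (nhds 0) := by
      have : Continuous fun t : ℝ => f (t • (x : Amb n)) := by fun_prop
      have h := this.tendsto 0
      rw [zero_smul, map_zero] at h
      exact h.mono_left nhdsWithin_le_nhds
    refine le_of_tendsto hlim ?_
    filter_upwards [self_mem_nhdsWithin] with t ht
    exact (hf _ ⟨t, ht, x, hx, rfl⟩).le
  have hfle : ∀ z ∈ Ω, f (z : Amb n) ≤ 0 := by
    intro z hz
    by_contra! hpos
    have := hf (((f b + 1) / f z) • (z : Amb n)) ⟨_, by positivity, z, hz, rfl⟩
    rw [map_smul, smul_eq_mul, div_mul_cancel₀ _ hpos.ne'] at this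
    linarith
  have hfb' : f b ≤ 0 := by
    have hcl : IsClosed {z : Sph n | f (z : Amb n) ≤ 0} :=
      isClosed_le (by fun_prop) continuous_const
    exact closure_minimal hfle hcl (frontier_subset_closure hb)
  have hfb0 : f b = 0 := le_antisymm hfb' hfb
  obtain ⟨w, hw⟩ : ∃ w : Amb n, ∀ z, ⟪w, z⟫ = -f z :=
    ⟨(InnerProductSpace.toDual ℝ (Amb n)).symm (-f), fun z => by simp⟩
  have hwpos : ∀ z ∈ Ω, 0 < ⟪w, (z : Amb n)⟫ := by
    intro z hz
    have := hf z (coe_mem_coneOver_iff.2 hz)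
    rw [hw]
    linarith
  have hw0 : w ≠ 0 := by
    rintro rfl
    obtain ⟨x, hx⟩ : Ω.Nonempty := closure_nonempty_iff.1 ⟨b, frontier_subset_closure hb⟩
    simpa using hwpos x hx
  have hinv : 0 < ‖w‖⁻¹ := inv_pos.2 (norm_pos_iff.2 hw0)
  have hb0 : ⟪‖w‖⁻¹ • w, (b : Amb n)⟫ = 0 := by
    rw [real_inner_smul_left, hw, hfb0]; simp
  refine ⟨‖w‖⁻¹ • w, ⟨norm_smul_inv_norm hw0, fun z hz => ?_, b, hb, hb0⟩, hb0⟩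
  rw [real_inner_smul_left]
  exact mul_pos hinv (hwpos z hz)

/-- A uniform lower bound for the support functionals at a point of `Ω`. -/
lemma exists_pos_le_inner {Ω : Set (Sph n)} (hopen : IsOpen Ω) {x : Sph n} (hx : x ∈ Ω) :
    ∃ m > 0, ∀ u ∈ supportVectors Ω, m ≤ ⟪u, (x : Amb n)⟫ := by
  obtain ⟨ε, hε, hball⟩ := Metric.isOpen_iff.1 (isOpen_coneOver hopen) _
    (coe_mem_coneOver_iff.2 hx)
  refine ⟨ε / 2, by positivity, fun u hu => ?_⟩
  -- Moving from x against u by ε / 2 stays in the cone, where u is positive; the move costs exactly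
  -- ε / 2.
  have hmem : (x : Amb n) - (ε / 2) • u ∈ coneOver Ω := by
    refine hball ?_
    rw [Metric.mem_ball, dist_eq_norm, sub_sub_cancel_left, norm_neg, norm_smul, hu.1, mul_one,
      Real.norm_eq_abs, abs_of_pos (by positivity)]
    linarith
  have := inner_pos_of_mem_coneOver hu.2.1 hmem
  rw [inner_sub_right, inner_smul_right, real_inner_self_eq_norm_sq, hu.1] at this
  linarith

/-- The ray from a point of `Ω` leaves `Ω` at a first boundary point, before the antipode. -/
lemma exists_exit {Ω : Set (Sph n)} (hopen : IsOpen Ω) (hconv : SphConvex Ω) {x : Sph n}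
    (hx : x ∈ Ω) {θ : Amb n} (hθ : ‖θ‖ = 1) (hxθ : ⟪(x : Amb n), θ⟫ = 0) :
    ∃ τ, 0 < τ ∧ τ < Real.pi ∧ (∃ b ∈ frontier Ω, (b : Amb n) = geod x θ τ) ∧
      ∀ σ, 0 ≤ σ → σ < τ → geod x θ σ ∈ coneOver Ω := by
  set S : Set ℝ := Set.Icc 0 Real.pi ∩ (geod (x : Amb n) θ) ⁻¹' (coneOver Ω)ᶜ with hS
  have hScl : IsClosed S :=
    isClosed_Icc.inter ((isOpen_coneOver hopen).isClosed_compl.preimage (continuous_geod _ _))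
  have hpi : Real.pi ∈ S := by
    refine ⟨⟨Real.pi_pos.le, le_rfl⟩, ?_⟩
    simpa [geod] using neg_notMem_coneOver hconv (coe_mem_coneOver_iff.2 hx)
  have hbdd : BddBelow S := ⟨0, fun t ht => ht.1.1⟩
  obtain ⟨τ, hτ⟩ : ∃ τ, τ = sInf S := ⟨_, rfl⟩
  have hτS : τ ∈ S := hτ ▸ hScl.csInf_mem ⟨_, hpi⟩ hbdd
  have hbefore : ∀ σ, 0 ≤ σ → σ < τ → geod (x : Amb n) θ σ ∈ coneOver Ω := by
    intro σ h0 h1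
    by_contra hn
    have : τ ≤ σ := hτ ▸ csInf_le hbdd ⟨⟨h0, h1.le.trans hτS.1.2⟩, hn⟩
    linarith
  have hτ0 : 0 < τ := by
    refine lt_of_le_of_ne hτS.1.1 ?_
    rintro rfl
    apply hτS.2
    rw [geod_zero]
    exact coe_mem_coneOver_iff.2 hx
  let g : ℝ → Sph n := fun t =>
    ⟨geod x θ t, mem_sphere_zero_iff_norm.2 (norm_geod (norm_coe_sph x) hθ hxθ t)⟩
  have hg : Continuous g := (continuous_geod _ _).subtype_mk _
  have hgmem : ∀ t, g t ∈ Ω ↔ geod (x : Amb n) θ t ∈ coneOver Ω := fun t =>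
    (coe_mem_coneOver_iff (z := g t)).symm
  have hfront : g τ ∈ frontier Ω := by
    rw [hopen.frontier_eq]
    refine ⟨?_, fun h => hτS.2 ((hgmem τ).1 h)⟩
    have hlim : Filter.Tendsto g (nhdsWithin τ (Set.Iio τ)) (nhds (g τ)) :=
      (hg.tendsto τ).mono_left nhdsWithin_le_nhds
    refine mem_closure_of_tendsto hlim ?_
    filter_upwards [Ioo_mem_nhdsLT hτ0] with t ht
    exact (hgmem t).2 (hbefore t ht.1.le ht.2)
  refine ⟨τ, hτ0, lt_of_le_of_ne hτS.1.2 ?_, ⟨g τ, hfront, rfl⟩, hbefore⟩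
  -- An exit at π would be at -x, so a support vector there would vanish at x too.
  rintro rfl
  obtain ⟨u, hu, hub⟩ := exists_supportVector hopen hconv hfront
  have h1 : ⟪u, geod (x : Amb n) θ Real.pi⟫ = 0 := hub
  rw [inner_geod] at h1
  simp at h1
  exact (hu.2.1 x hx).ne' h1

lemma exists_unit_tangent (hn : 1 ≤ n) (x : Sph n) :
    ∃ θ : Amb n, ‖θ‖ = 1 ∧ ⟪(x : Amb n), θ⟫ = 0 := by
  have hfr : Module.finrank ℝ (tangent x) = n := by
    have hx0 : (x : Amb n) ≠ 0 := by
      rw [← norm_ne_zero_iff, norm_coe_sph]; exact one_ne_zero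
    have : Fact (Module.finrank ℝ (Amb n) = n + 1) := ⟨by simp⟩
    exact Submodule.finrank_orthogonal_span_singleton hx0
  have : Nontrivial (tangent x) := Module.nontrivial_of_finrank_pos (R := ℝ) (by omega)
  obtain ⟨v, hv⟩ := exists_ne (0 : tangent x)
  have hv0 : (v : Amb n) ≠ 0 := fun h => hv (Subtype.ext h)
  refine ⟨‖(v : Amb n)‖⁻¹ • (v : Amb n), norm_smul_inv_norm hv0, ?_⟩
  rw [inner_smul_right, mem_tangent_iff.1 v.2, mul_zero]

/-- Any tangent direction leads to a boundary point, and `1 ≤ n` guarantees that one exists. -/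
lemma supportVectors_nonempty (hn : 1 ≤ n) {Ω : Set (Sph n)} (hopen : IsOpen Ω)
    (hconv : SphConvex Ω) {x : Sph n} (hx : x ∈ Ω) : (supportVectors Ω).Nonempty := by
  obtain ⟨θ, hθ, hxθ⟩ := exists_unit_tangent hn x
  obtain ⟨τ, -, -, ⟨b, hb, -⟩, -⟩ := exists_exit hopen hconv hx hθ hxθ
  obtain ⟨u, hu, -⟩ := exists_supportVector hopen hconv hb
  exact ⟨u, hu⟩

/-- The diameter bound keeps the points of `Ω` away from the poles of supporting hyperplanes. -/
lemma inner_lt_one {Ω : Set (Sph n)} (hdiam : DiamLtPiDivTwo Ω) {x : Sph n} (hx : x ∈ Ω)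
    {u : Amb n} (hu : u ∈ supportVectors Ω) : ⟪u, (x : Amb n)⟫ < 1 := by
  obtain ⟨D, hD, hdist⟩ := hdiam
  obtain ⟨hu1, -, b, hb, hub⟩ := hu
  have hxb : sdist (x : Amb n) b ≤ D := by
    have hcl : IsClosed {z : Sph n | sdist (x : Amb n) z ≤ D} := by
      have : {z : Sph n | sdist (x : Amb n) z ≤ D} =
          {z : Sph n | Real.arccos ⟪(x : Amb n), (z : Amb n)⟫ ≤ D} := by
        ext z
        rw [Set.mem_ofPred_eq, sdist_eq_arccos (norm_coe_sph x) (norm_coe_sph z), Set.mem_ofPred_eq]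
      rw [this]
      exact isClosed_le (Real.continuous_arccos.comp
        (continuous_const.inner continuous_subtype_val)) continuous_const
    exact closure_minimal (fun z hz => hdist x hx z hz) hcl (frontier_subset_closure hb)
  refine lt_of_le_of_ne ?_ fun h => ?_
  · simpa [hu1] using real_inner_le_norm u (x : Amb n)
  -- Equality would give u = x, at distance π / 2 from the boundary point b, beyond the diameter.
  · rw [inner_eq_one_iff_of_norm_eq_one hu1 (norm_coe_sph x)] at h
    rw [sdist_eq_arccos (norm_coe_sph x) (norm_coe_sph b), ← h, hub, Real.arccos_zero] at hxb
    linarith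

/-! ### Both functionals as one supremum over support vectors -/

lemma mem_supporting_iff {Ω : Set (Sph n)} {P : Set (Sph n)} :
    P ∈ supporting Ω ↔ ∃ u ∈ supportVectors Ω, P = hyperplane u := by
  constructor
  · rintro ⟨u, hu, rfl, hpos, b, hb, hbP⟩
    exact ⟨u, ⟨hu, hpos, b, hb, hbP⟩, rfl⟩
  · rintro ⟨u, ⟨hu, hpos, b, hb, hbP⟩, rfl⟩
    exact ⟨u, hu, rfl, hpos, b, hb, hbP⟩

/-- Comparing ranges, not just suprema, lets boundedness be transferred as well. -/
lemma range_supporting {Ω : Set (Sph n)} {f : Set (Sph n) → ℝ} {g : Amb n → ℝ}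
    (h : ∀ u ∈ supportVectors Ω, f (hyperplane u) = g u) :
    (Set.range fun P : supporting Ω => f P) = Set.range fun u : supportVectors Ω => g u := by
  ext t
  constructor
  · rintro ⟨⟨P, hP⟩, rfl⟩
    obtain ⟨u, hu, rfl⟩ := mem_supporting_iff.1 hP
    exact ⟨⟨u, hu⟩, (h u hu).symm⟩
  · rintro ⟨⟨u, hu⟩, rfl⟩
    exact ⟨⟨_, mem_supporting_iff.2 ⟨u, hu, rfl⟩⟩, h u hu⟩

lemma range_term₁ {Ω : Set (Sph n)} {x : Sph n} (hx : x ∈ Ω) {ξ : Amb n} (hξ : ξ ∈ tangent x) :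
    (Set.range fun P : supporting Ω => term₁ (P : Set (Sph n)) x ξ) =
      Set.range fun u : supportVectors Ω => -⟪(u : Amb n), ξ⟫ / ⟪(u : Amb n), (x : Amb n)⟫ :=
  range_supporting (f := fun P => term₁ P x ξ)
    (g := fun u => -⟪u, ξ⟫ / ⟪u, (x : Amb n)⟫) fun _ hu => term₁_hyperplane (hu.2.1 x hx) hξ

lemma range_term₂ {Ω : Set (Sph n)} (hdiam : DiamLtPiDivTwo Ω) {x : Sph n} (hx : x ∈ Ω)
    {ξ : Amb n} (hξ : ξ ∈ tangent x) :
    (Set.range fun P : supporting Ω => term₂ (P : Set (Sph n)) x ξ) =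
      Set.range fun u : supportVectors Ω => -⟪(u : Amb n), ξ⟫ / ⟪(u : Amb n), (x : Amb n)⟫ :=
  range_supporting (f := fun P => term₂ P x ξ) (g := fun u => -⟪u, ξ⟫ / ⟪u, (x : Amb n)⟫)
    fun _ hu => term₂_hyperplane hu.1 (hu.2.1 x hx) (inner_lt_one hdiam hx hu) hξ

lemma mink₁_eq {Ω : Set (Sph n)} {x : Sph n} (hx : x ∈ Ω) {ξ : Amb n} (hξ : ξ ∈ tangent x) :
    mink₁ Ω x ξ = coneNorm Ω x ξ := by
  rw [mink₁, coneNorm, iSup, iSup, range_term₁ hx hξ]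

lemma mink₂_eq {Ω : Set (Sph n)} (hdiam : DiamLtPiDivTwo Ω) {x : Sph n} (hx : x ∈ Ω)
    {ξ : Amb n} (hξ : ξ ∈ tangent x) : mink₂ Ω x ξ = coneNorm Ω x ξ := by
  rw [mink₂, coneNorm, iSup, iSup, range_term₂ hdiam hx hξ]

/-! ### Finiteness, convexity and continuity of the supremum -/

lemma bddAbove_coneNorm {Ω : Set (Sph n)} {x : Amb n} {m : ℝ} (hm : 0 < m)
    (h : ∀ u ∈ supportVectors Ω, m ≤ ⟪u, x⟫) (ξ : Amb n) :
    BddAbove (Set.range fun u : supportVectors Ω => -⟪(u : Amb n), ξ⟫ / ⟪(u : Amb n), x⟫) := by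
  refine ⟨‖ξ‖ / m, ?_⟩
  rintro _ ⟨⟨u, hu⟩, rfl⟩
  have h1 : -⟪u, ξ⟫ ≤ ‖ξ‖ := by
    have := real_inner_le_norm (-u) ξ
    rwa [inner_neg_left, norm_neg, hu.1, one_mul] at this
  exact (div_le_div_of_nonneg_right h1 (hm.le.trans (h u hu))).trans
    (div_le_div_of_nonneg_left (norm_nonneg _) hm (h u hu))

lemma coneNorm_zero (Ω : Set (Sph n)) (x : Amb n) : coneNorm Ω x 0 = 0 := by
  simp [coneNorm]

lemma coneNorm_convexOn {Ω : Set (Sph n)} (hne : (supportVectors Ω).Nonempty) {x : Amb n} {m : ℝ}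
    (hm : 0 < m) (h : ∀ u ∈ supportVectors Ω, m ≤ ⟪u, x⟫) {s : Set (Amb n)} (hs : Convex ℝ s) :
    ConvexOn ℝ s (coneNorm Ω x) := by
  refine ⟨hs, fun ξ _ ζ _ a b ha hb _ => ?_⟩
  have : Nonempty (supportVectors Ω) := hne.to_subtype
  refine ciSup_le fun u => ?_
  have h1 := le_ciSup (bddAbove_coneNorm hm h ξ) u
  have h2 := le_ciSup (bddAbove_coneNorm hm h ζ) u
  have h3 := add_le_add (mul_le_mul_of_nonneg_left h1 ha) (mul_le_mul_of_nonneg_left h2 hb)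
  refine le_trans (le_of_eq ?_) h3
  rw [inner_add_right, inner_smul_right, inner_smul_right]
  ring

lemma abs_ciSup_sub_ciSup_le {ι : Type*} [Nonempty ι] {f g : ι → ℝ} (hf : BddAbove (Set.range f))
    (hg : BddAbove (Set.range g)) {δ : ℝ} (h : ∀ i, |f i - g i| ≤ δ) :
    |(⨆ i, f i) - ⨆ i, g i| ≤ δ := by
  rw [abs_sub_le_iff]
  constructor
  · rw [sub_le_iff_le_add]
    exact ciSup_le fun i => by
      linarith [(abs_sub_le_iff.1 (h i)).1, le_ciSup hg i]
  · rw [sub_le_iff_le_add]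
    exact ciSup_le fun i => by
      linarith [(abs_sub_le_iff.1 (h i)).2, le_ciSup hf i]

/-- `coneNorm` is jointly continuous. -/
lemma continuousAt_coneNorm {Ω : Set (Sph n)} (hne : (supportVectors Ω).Nonempty) {x : Amb n}
    {m : ℝ} (hm : 0 < m) (h : ∀ u ∈ supportVectors Ω, m ≤ ⟪u, x⟫) (ξ : Amb n) :
    ContinuousAt (fun p : Amb n × Amb n => coneNorm Ω p.1 p.2) (x, ξ) := by
  have : Nonempty (supportVectors Ω) := hne.to_subtype
  -- Within distance m / 2 of x all support functionals stay above m / 2, so the terms are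
  -- equicontinuous and the supremum inherits their common modulus.
  set M := m / 2 with hM
  have hM0 : 0 < M := by positivity
  have hnear : ∀ y : Amb n, ‖y - x‖ < M → ∀ u ∈ supportVectors Ω, M ≤ ⟪u, y⟫ := by
    intro y hy u hu
    have h1 := real_inner_le_norm u (x - y)
    rw [hu.1, one_mul, norm_sub_rev, inner_sub_right] at h1
    have := h u hu
    linarith
  have hlim : Filter.Tendsto
      (fun p : Amb n × Amb n => ‖p.2 - ξ‖ / M + ‖ξ‖ * ‖p.1 - x‖ / (M * M)) (nhds (x, ξ))
      (nhds 0) := by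
    have hc : Continuous
      (fun p : Amb n × Amb n => ‖p.2 - ξ‖ / M + ‖ξ‖ * ‖p.1 - x‖ / (M * M)) := by fun_prop
    have := hc.tendsto (x, ξ)
    simpa using this
  rw [ContinuousAt, tendsto_iff_dist_tendsto_zero]
  refine squeeze_zero' (Filter.Eventually.of_forall fun _ => dist_nonneg) ?_ hlim
  have hev : ∀ᶠ p : Amb n × Amb n in nhds (x, ξ), ‖p.1 - x‖ < M := by
    have hc : Continuous fun p : Amb n × Amb n => ‖p.1 - x‖ := by fun_prop
    exact hc.tendsto (x, ξ) |>.eventually_lt_const (by simpa using hM0)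
  filter_upwards [hev] with p hp
  rw [Real.dist_eq]
  refine abs_ciSup_sub_ciSup_le (bddAbove_coneNorm hM0 (hnear _ hp) _)
    (bddAbove_coneNorm hm h _) ?_
  rintro ⟨u, hu⟩
  have hy := hnear _ hp u hu
  have hx : M ≤ ⟪u, x⟫ := by have := h u hu; linarith
  have hy0 := hM0.trans_le hy
  have hx0 := hM0.trans_le hx
  have habs : ∀ v : Amb n, |⟪u, v⟫| ≤ ‖v‖ := fun v => by
    simpa [hu.1] using abs_real_inner_le_norm u v
  have heq : -⟪u, p.2⟫ / ⟪u, p.1⟫ - -⟪u, ξ⟫ / ⟪u, x⟫ =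
      -⟪u, p.2 - ξ⟫ / ⟪u, p.1⟫ + ⟪u, ξ⟫ * ⟪u, p.1 - x⟫ / (⟪u, p.1⟫ * ⟪u, x⟫) := by
    rw [inner_sub_right, inner_sub_right]
    field_simp
    ring
  simp only
  rw [heq]
  refine (abs_add_le _ _).trans (add_le_add ?_ ?_)
  · rw [abs_div, abs_neg, abs_of_pos hy0]
    gcongr
    exact habs _
  · rw [abs_div, abs_mul, abs_of_pos (mul_pos hy0 hx0)]
    gcongr
    · exact habs _
    · exact habs _

/-! ### Curves -/

/-- The velocity of a curve in the sphere is tangent to the sphere. -/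
lemma deriv_mem_tangent (γ : ℝ → Sph n) (t : ℝ) :
    deriv (fun s => (γ s : Amb n)) t ∈ tangent (γ t) := by
  rw [mem_tangent_iff]
  by_cases hd : DifferentiableAt ℝ (fun s => (γ s : Amb n)) t
  · have h1 := hd.hasDerivAt.inner ℝ hd.hasDerivAt
    simp only [inner_self_sph] at h1
    have h2 := h1.unique (hasDerivAt_const t (1 : ℝ))
    rw [real_inner_comm (γ t : Amb n) (deriv _ t)] at h2
    linarith
  -- Where γ is not differentiable `deriv` defaults to 0, which is tangent.
  · rw [deriv_zero_of_not_differentiableAt hd, inner_zero_right]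

/-- Along a piecewise `C¹` curve, a continuous function of position and velocity is integrable. -/
lemma PiecewiseC1.intervalIntegrable {γ : ℝ → Amb n} {a b : ℝ} (hab : a ≤ b)
    (hγ : PiecewiseC1 γ a b) {g : Amb n → Amb n → ℝ}
    (hg : ∀ t ∈ Set.Icc a b, ∀ v, ContinuousAt (fun p : Amb n × Amb n => g p.1 p.2) (γ t, v)) :
    IntervalIntegrable (fun t => g (γ t) (deriv γ t)) MeasureTheory.volume a b := by
  obtain ⟨-, s, hs⟩ := hγ
  -- Induction on the number of break points inside the interval, splitting at one of them.
  have key : ∀ N : ℕ, ∀ c ∈ Set.Icc a b, ∀ d ∈ Set.Icc a b, c ≤ d →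
      (s.filter fun t => c < t ∧ t < d).card = N →
      IntervalIntegrable (fun t => g (γ t) (deriv γ t)) MeasureTheory.volume c d := by
    intro N
    induction N using Nat.strong_induction_on with
    | _ N ih =>
      intro c hc d hd hcd hN
      rcases hcd.eq_or_lt with rfl | hlt
      · exact IntervalIntegrable.refl
      by_cases hex : ∃ t ∈ s, c < t ∧ t < d
      · obtain ⟨t, hts, hct, htd⟩ := hex
        have htI : t ∈ Set.Icc a b := ⟨hc.1.trans hct.le, htd.le.trans hd.2⟩
        have hmem : t ∈ s.filter fun t => c < t ∧ t < d :=
          Finset.mem_filter.2 ⟨hts, hct, htd⟩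
        have h1 : (s.filter fun r => c < r ∧ r < t).card < N := by
          rw [← hN]
          refine Finset.card_lt_card (Finset.ssubset_iff_subset_ne.2 ⟨?_, fun h => ?_⟩)
          · intro r hr
            rw [Finset.mem_filter] at hr ⊢
            exact ⟨hr.1, hr.2.1, hr.2.2.trans htd⟩
          · rw [← h, Finset.mem_filter] at hmem
            exact lt_irrefl _ hmem.2.2
        have h2 : (s.filter fun r => t < r ∧ r < d).card < N := by
          rw [← hN]
          refine Finset.card_lt_card (Finset.ssubset_iff_subset_ne.2 ⟨?_, fun h => ?_⟩)
          · intro r hr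
            rw [Finset.mem_filter] at hr ⊢
            exact ⟨hr.1, hct.trans hr.2.1, hr.2.2⟩
          · rw [← h, Finset.mem_filter] at hmem
            exact lt_irrefl _ hmem.2.1
        exact (ih _ h1 c hc t htI hct.le rfl).trans (ih _ h2 t htI d hd htd.le rfl)
      · push Not at hex
        have hC1 := hs c hc d hd hlt fun t ht htI => absurd htI.2 (not_lt.2 (hex t ht htI.1))
        have hcont : ContinuousOn (fun t => g (γ t) (derivWithin γ (Set.Icc c d) t))
            (Set.Icc c d) := by
          intro t ht
          have hpair : ContinuousWithinAt (fun t => (γ t, derivWithin γ (Set.Icc c d) t))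
              (Set.Icc c d) t :=
            (hC1.continuousOn t ht).prodMk
              (hC1.continuousOn_derivWithin (uniqueDiffOn_Icc hlt) le_rfl t ht)
          exact (hg t ⟨hc.1.trans ht.1, ht.2.trans hd.2⟩ _).comp_continuousWithinAt
            (f := fun t => (γ t, derivWithin γ (Set.Icc c d) t)) hpair
        -- The one-sided derivative is continuous up to the ends and agrees with `deriv` in the
        -- interior, which suffices for integrability.
        refine (hcont.intervalIntegrable_of_Icc hcd).congr_uIoo fun t ht => ?_
        rw [Set.uIoo_of_le hcd] at ht
        simp only
        rw [derivWithin_of_mem_nhds (Icc_mem_nhds ht.1 ht.2)]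
  exact key _ a (Set.left_mem_Icc.2 hab) b (Set.right_mem_Icc.2 hab) hab rfl

lemma PiecewiseC1.differentiableAt {γ : ℝ → Amb n} {a b : ℝ} (hγ : PiecewiseC1 γ a b) :
    ∃ s : Finset ℝ, ∀ t ∈ Set.Ioo a b \ (s : Set ℝ), DifferentiableAt ℝ γ t := by
  obtain ⟨-, s, hs⟩ := hγ
  refine ⟨s, fun t ht => ?_⟩
  have hopen : IsOpen (Set.Ioo a b \ (s : Set ℝ)) := isOpen_Ioo.sdiff s.finite_toSet.isClosed
  obtain ⟨ε, hε, hball⟩ := Metric.isOpen_iff.1 hopen t ht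
  rw [Real.ball_eq_Ioo] at hball
  have hsub : ∀ r ∈ Set.Icc (t - ε / 2) (t + ε / 2), r ∈ Set.Ioo a b \ (s : Set ℝ) := fun r hr =>
    hball ⟨by linarith [hr.1], by linarith [hr.2]⟩
  have h1 := hsub (t - ε / 2) ⟨le_rfl, by linarith⟩
  have h2 := hsub (t + ε / 2) ⟨by linarith, le_rfl⟩
  have hC1 := hs _ ⟨h1.1.1.le, h1.1.2.le⟩ _ ⟨h2.1.1.le, h2.1.2.le⟩ (by linarith)
    fun r hr hrI => (hsub r ⟨hrI.1.le, hrI.2.le⟩).2 hr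
  exact (hC1.differentiableOn one_ne_zero).differentiableAt
    (Icc_mem_nhds (by linarith) (by linarith))

section Curve

variable {Ω : Set (Sph n)} {γ : ℝ → Sph n} {a b : ℝ} {x y : Sph n}

lemma IsCurve.intervalIntegrable_coneNorm (hopen : IsOpen Ω) (hne : (supportVectors Ω).Nonempty)
    (hγ : IsCurve Ω γ a b x y) :
    IntervalIntegrable (fun t => coneNorm Ω (γ t) (deriv (fun s => (γ s : Amb n)) t))
      MeasureTheory.volume a b := by
  refine hγ.piecewise.intervalIntegrable hγ.lt.le fun t ht v => ?_
  obtain ⟨m, hm, h⟩ := exists_pos_le_inner hopen (hγ.mem t ht)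
  exact continuousAt_coneNorm hne hm h v

/-- The length of a curve bounds the logarithm of the ratio of a support functional. -/
lemma IsCurve.log_le_integral (hopen : IsOpen Ω) (hγ : IsCurve Ω γ a b x y) {u : Amb n}
    (hu : u ∈ supportVectors Ω) :
    Real.log (⟪u, (x : Amb n)⟫ / ⟪u, (y : Amb n)⟫) ≤
      ∫ t in a..b, coneNorm Ω (γ t) (deriv (fun s => (γ s : Amb n)) t) := by
  have hpos : ∀ t ∈ Set.Icc a b, 0 < ⟪u, (γ t : Amb n)⟫ := fun t ht => hu.2.1 _ (hγ.mem t ht)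
  have hint : IntervalIntegrable
      (fun t => -⟪u, deriv (fun s => (γ s : Amb n)) t⟫ / ⟪u, (γ t : Amb n)⟫)
      MeasureTheory.volume a b := by
    refine hγ.piecewise.intervalIntegrable (g := fun z v => -⟪u, v⟫ / ⟪u, z⟫) hγ.lt.le
      fun t ht v => ?_
    exact ContinuousAt.div (by fun_prop) (by fun_prop) (hpos t ht).ne'
  obtain ⟨s, hs⟩ := hγ.piecewise.differentiableAt
  -- The fundamental theorem for -log ⟪u, γ⟫, which is continuous everywhere and differentiable off
  -- the break points.
  have hftc := MeasureTheory.integral_eq_of_hasDerivAt_off_countable_of_le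
    (fun t => -Real.log ⟪u, (γ t : Amb n)⟫)
    (fun t => -⟪u, deriv (fun s => (γ s : Amb n)) t⟫ / ⟪u, (γ t : Amb n)⟫) hγ.lt.le
    s.countable_toSet
    ((ContinuousOn.log (continuousOn_const.inner hγ.piecewise.1)
      fun t ht => (hpos t ht).ne').neg)
    (fun t ht => by
      have h1 := (innerSL ℝ u).hasFDerivAt.comp_hasDerivAt t (hs t ht).hasDerivAt
      have h2 := (h1.log (hpos t (Set.Ioo_subset_Icc_self ht.1)).ne').neg
      refine h2.congr_deriv ?_
      simp [neg_div])
    hint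
  have hx := hu.2.1 x (hγ.left ▸ hγ.mem a (Set.left_mem_Icc.2 hγ.lt.le))
  have hy := hu.2.1 y (hγ.right ▸ hγ.mem b (Set.right_mem_Icc.2 hγ.lt.le))
  rw [hγ.left, hγ.right] at hftc
  have hlog : Real.log (⟪u, (x : Amb n)⟫ / ⟪u, (y : Amb n)⟫) =
      -Real.log ⟪u, (y : Amb n)⟫ - -Real.log ⟪u, (x : Amb n)⟫ := by
    rw [Real.log_div hx.ne' hy.ne']; ring
  rw [hlog, ← hftc]
  refine intervalIntegral.integral_mono_on hγ.lt.le hint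
    (hγ.intervalIntegrable_coneNorm hopen ⟨u, hu⟩) fun t ht => ?_
  obtain ⟨m, hm, h⟩ := exists_pos_le_inner hopen (hγ.mem t ht)
  exact le_ciSup (bddAbove_coneNorm hm h (deriv (fun s => (γ s : Amb n)) t)) ⟨u, hu⟩

end Curve

/-! ### The geodesic through two points and the Funk metric -/

/-- The data of the geodesic from `x` through `y` to the boundary. -/
lemma exists_geod_data {Ω : Set (Sph n)} (hopen : IsOpen Ω) (hconv : SphConvex Ω)
    {x y : Sph n} (hx : x ∈ Ω) (hy : y ∈ Ω) (hxy : x ≠ y) :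
    ∃ (θ : Amb n) (d τ : ℝ) (b : Sph n), ‖θ‖ = 1 ∧ ⟪(x : Amb n), θ⟫ = 0 ∧ dir x y = θ ∧
      0 < d ∧ d < τ ∧ τ < Real.pi ∧ (y : Amb n) = geod x θ d ∧ b ∈ frontier Ω ∧
      (b : Amb n) = geod x θ τ ∧ (∀ σ, 0 ≤ σ → σ < τ → geod x θ σ ∈ coneOver Ω) ∧
      bdryPoint Ω x y = geod x θ τ := by
  set c := ⟪(x : Amb n), (y : Amb n)⟫ with hc
  set w := (y : Amb n) - c • (x : Amb n) with hw
  have hxw : ⟪(x : Amb n), w⟫ = 0 := by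
    rw [hw, inner_sub_right, inner_smul_right, inner_self_sph, ← hc]; ring
  have hyx : ⟪(y : Amb n), (x : Amb n)⟫ = c := real_inner_comm _ _
  have hw2 : ‖w‖ ^ 2 = 1 - c ^ 2 := by
    rw [← real_inner_self_eq_norm_sq, hw]
    simp only [inner_sub_left, inner_sub_right, inner_smul_left, inner_smul_right,
      inner_self_sph, hyx, ← hc]
    simp
    ring
  have hc1 : c < 1 := by
    refine lt_of_le_of_ne ?_ fun h => hxy ?_
    · simpa [norm_coe_sph] using real_inner_le_norm (x : Amb n) (y : Amb n)
    · exact Subtype.ext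
        ((inner_eq_one_iff_of_norm_eq_one (norm_coe_sph x) (norm_coe_sph y)).1 h)
  have hc2 : -1 < c := by
    refine lt_of_le_of_ne ?_ fun h => ?_
    · have := neg_le_of_abs_le (abs_real_inner_le_norm (x : Amb n) (y : Amb n))
      simpa [norm_coe_sph] using this
    · have hneg : ⟪(x : Amb n), -(y : Amb n)⟫ = 1 := by rw [inner_neg_right]; linarith
      rw [inner_eq_one_iff_of_norm_eq_one (norm_coe_sph x)
        (by rw [norm_neg, norm_coe_sph])] at hneg
      refine neg_notMem_coneOver hconv (coe_mem_coneOver_iff.2 hy) ?_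
      rw [← hneg]
      exact coe_mem_coneOver_iff.2 hx
  have hwn : ‖w‖ = √(1 - c ^ 2) := by rw [← hw2, Real.sqrt_sq (norm_nonneg _)]
  have hw0 : 0 < ‖w‖ := hwn ▸ Real.sqrt_pos.2 (by nlinarith)
  have hθ : ‖dir x y‖ = 1 := norm_smul_inv_norm (norm_pos_iff.1 hw0)
  have hxθ : ⟪(x : Amb n), dir x y⟫ = 0 := by
    change ⟪(x : Amb n), ‖w‖⁻¹ • w⟫ = 0
    rw [inner_smul_right, hxw, mul_zero]
  have hd0 : 0 < Real.arccos c := Real.arccos_pos.2 hc1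
  have hygeod : (y : Amb n) = geod x (dir x y) (Real.arccos c) := by
    change (y : Amb n) = Real.cos (Real.arccos c) • (x : Amb n) +
      Real.sin (Real.arccos c) • ‖w‖⁻¹ • w
    rw [Real.cos_arccos hc2.le hc1.le, Real.sin_arccos, ← hwn, smul_smul,
      mul_inv_cancel₀ hw0.ne', one_smul, hw]
    abel
  obtain ⟨τ, hτ0, hτpi, ⟨b, hb, hbeq⟩, hbefore⟩ := exists_exit hopen hconv hx hθ hxθ
  have hfirst : bdryPoint Ω x y = geod x (dir x y) τ := by
    have h1 := firstPoint_eq (A := frontier Ω) (x := x) hθ one_pos hτ0 ⟨b, hb, hbeq⟩ ?_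
    · rwa [one_smul] at h1
    · rintro σ hσ hστ ⟨z, hz, hzeq⟩
      rw [hopen.frontier_eq] at hz
      exact hz.2 (coe_mem_coneOver_iff.1 (hzeq ▸ hbefore σ hσ.le hστ))
  refine ⟨dir x y, Real.arccos c, τ, b, hθ, hxθ, rfl, hd0, ?_, hτpi, hygeod, hb, hbeq, hbefore,
    hfirst⟩
  -- If the exit came no later than y, then b would be y or a positive combination of x and y, hence
  -- in the open cone.
  by_contra! hle
  have hbΩ : (b : Amb n) ∉ coneOver Ω := fun h =>
    ((hopen.frontier_eq ▸ hb : b ∈ closure Ω \ Ω)).2 (coe_mem_coneOver_iff.1 h)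
  rcases hle.eq_or_lt with h | hlt
  · apply hbΩ
    rw [hbeq, h, ← hygeod]
    exact coe_mem_coneOver_iff.2 hy
  · have hdpi : Real.arccos c < Real.pi :=
      lt_of_le_of_ne (Real.arccos_le_pi c) fun h => hc2.not_ge (Real.arccos_eq_pi.1 h)
    have hsd := Real.sin_pos_of_pos_of_lt_pi hd0 hdpi
    apply hbΩ
    rw [← smul_mem_coneOver_iff hsd, hbeq, sin_smul_geod, ← hygeod]
    exact add_mem_coneOver hconv hx hy
      (Real.sin_pos_of_pos_of_lt_pi (by linarith) (by linarith))
      (Real.sin_pos_of_pos_of_lt_pi hτ0 hτpi)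

/-- The boundary point is cos(τ - σ) times the position plus sin(τ - σ) times the velocity.
Nonnegativity of each support functional at b bounds its term by cot(τ - σ), with equality for u
since u vanishes at b. -/
lemma coneNorm_geod {Ω : Set (Sph n)} {x θ : Amb n} {τ σ : ℝ} {b : Sph n}
    (hb : b ∈ frontier Ω) (hbeq : (b : Amb n) = geod x θ τ) (hσ : σ < τ) (hσ' : τ - σ < Real.pi)
    (hmem : geod x θ σ ∈ coneOver Ω) {u : Amb n} (hu : u ∈ supportVectors Ω)
    (hub : ⟪u, (b : Amb n)⟫ = 0) :
    coneNorm Ω (geod x θ σ) (Real.cos σ • θ - Real.sin σ • x) =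
      Real.cos (τ - σ) / Real.sin (τ - σ) := by
  have hsin : 0 < Real.sin (τ - σ) := Real.sin_pos_of_pos_of_lt_pi (by linarith) hσ'
  have hexp : (b : Amb n) = Real.cos (τ - σ) • geod x θ σ +
      Real.sin (τ - σ) • (Real.cos σ • θ - Real.sin σ • x) := by
    have h1 : Real.cos τ = Real.cos (τ - σ) * Real.cos σ - Real.sin (τ - σ) * Real.sin σ := by
      rw [← Real.cos_add, sub_add_cancel]
    have h2 : Real.sin τ = Real.sin (τ - σ) * Real.cos σ + Real.cos (τ - σ) * Real.sin σ := by
      rw [← Real.sin_add, sub_add_cancel]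
    rw [hbeq, geod, geod, h1, h2]
    module
  have hinner : ∀ v : Amb n, ⟪v, (b : Amb n)⟫ = Real.cos (τ - σ) * ⟪v, geod x θ σ⟫ +
      Real.sin (τ - σ) * ⟪v, Real.cos σ • θ - Real.sin σ • x⟫ := fun v => by
    rw [hexp, inner_add_right, inner_smul_right, inner_smul_right]
  have hle : ∀ v : supportVectors Ω,
      -⟪(v : Amb n), Real.cos σ • θ - Real.sin σ • x⟫ / ⟪(v : Amb n), geod x θ σ⟫ ≤
        Real.cos (τ - σ) / Real.sin (τ - σ) := by
    rintro ⟨v, hv⟩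
    have hv0 := inner_pos_of_mem_coneOver hv.2.1 hmem
    have h1 := inner_nonneg_of_mem_frontier hv.2.1 hb
    rw [hinner] at h1
    rw [div_le_div_iff₀ hv0 hsin]
    simp only
    linarith
  have : Nonempty (supportVectors Ω) := ⟨⟨u, hu⟩⟩
  refine le_antisymm (ciSup_le hle) (le_trans (le_of_eq ?_)
    (le_ciSup (Set.forall_mem_range.2 hle |> fun h => ⟨_, h⟩) ⟨u, hu⟩))
  have hu0 := inner_pos_of_mem_coneOver hu.2.1 hmem
  rw [hinner] at hub
  rw [div_eq_div_iff hsin.ne' hu0.ne']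
  linarith

lemma funk_eq {Ω : Set (Sph n)} {x y : Sph n} (hxy : x ≠ y) {θ : Amb n} {d τ : ℝ}
    (hθ : ‖θ‖ = 1) (hxθ : ⟪(x : Amb n), θ⟫ = 0) (h0 : 0 < d) (h1 : d < τ) (h2 : τ < Real.pi)
    (hy : (y : Amb n) = geod x θ d) (hb : bdryPoint Ω x y = geod x θ τ) :
    funk Ω x y = Real.log (Real.sin τ / Real.sin (τ - d)) := by
  have e1 : sdist (x : Amb n) (geod x θ τ) = τ := by
    have := sdist_geod (norm_coe_sph x) hθ hxθ (σ := 0) (τ := τ) (by linarith) (by linarith)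
    simpa using this
  rw [funk, if_neg hxy, hb, e1, hy,
    sdist_geod (norm_coe_sph x) hθ hxθ h1.le (by linarith)]

/-- A support functional at the exit point realizes the Funk metric. -/
lemma funk_eq_log {Ω : Set (Sph n)} (hopen : IsOpen Ω) (hconv : SphConvex Ω)
    {x y : Sph n} (hx : x ∈ Ω) (hy : y ∈ Ω) (hxy : x ≠ y) :
    ∃ u ∈ supportVectors Ω,
      funk Ω x y = Real.log (⟪u, (x : Amb n)⟫ / ⟪u, (y : Amb n)⟫) := by
  obtain ⟨θ, d, τ, b, hθ, hxθ, -, hd, hdτ, hτ, hyeq, hb, hbeq, -, hbd⟩ :=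
    exists_geod_data hopen hconv hx hy hxy
  obtain ⟨u, hu, hub⟩ := exists_supportVector hopen hconv hb
  refine ⟨u, hu, ?_⟩
  rw [funk_eq hxy hθ hxθ hd hdτ hτ hyeq hbd]
  -- Pairing sin τ y = sin(τ - d) x + sin d b with u removes b and leaves the ratio of sines.
  have hs := sin_smul_geod (x : Amb n) θ τ d
  rw [← hyeq, ← hbeq] at hs
  have h1 := congrArg (fun v => ⟪u, v⟫) hs
  simp only [inner_add_right, inner_smul_right, hub, mul_zero, add_zero] at h1
  have hy0 := hu.2.1 y hy
  have hsin := Real.sin_pos_of_pos_of_lt_pi (x := τ - d) (by linarith) (by linarith)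
  congr 1
  rw [div_eq_div_iff hsin.ne' hy0.ne']
  linarith

/-- The geodesic realizes the Funk metric. -/
lemma exists_curve_length_eq_funk {Ω : Set (Sph n)} (hopen : IsOpen Ω) (hconv : SphConvex Ω)
    {x y : Sph n} (hx : x ∈ Ω) (hy : y ∈ Ω) (hxy : x ≠ y) :
    ∃ (γ : ℝ → Sph n) (a b : ℝ), IsCurve Ω γ a b x y ∧
      funk Ω x y = ∫ t in a..b, coneNorm Ω (γ t) (deriv (fun s => (γ s : Amb n)) t) := by
  obtain ⟨θ, d, τ, b, hθ, hxθ, -, hd, hdτ, hτ, hyeq, hb, hbeq, hmem, hbd⟩ :=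
    exists_geod_data hopen hconv hx hy hxy
  obtain ⟨u, hu, hub⟩ := exists_supportVector hopen hconv hb
  let γ : ℝ → Sph n := fun t =>
    ⟨geod x θ t, mem_sphere_zero_iff_norm.2 (norm_geod (norm_coe_sph x) hθ hxθ t)⟩
  have hγ : (fun t => (γ t : Amb n)) = geod (x : Amb n) θ := rfl
  have hsmooth : ContDiff ℝ 1 (geod (x : Amb n) θ) := by unfold geod; fun_prop
  refine ⟨γ, 0, d, ⟨hd, Subtype.ext (geod_zero _ _), Subtype.ext hyeq.symm, fun t ht => ?_, ?_⟩, ?_⟩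
  · exact coe_mem_coneOver_iff.1 (hmem t ht.1 (ht.2.trans_lt hdτ))
  · rw [hγ]
    exact ⟨(continuous_geod _ _).continuousOn, ∅, fun c _ d _ _ _ => hsmooth.contDiffOn⟩
  · rw [funk_eq hxy hθ hxθ hd hdτ hτ hyeq hbd]
    have hsin : ∀ t ∈ Set.uIcc 0 d, 0 < Real.sin (τ - t) := fun t ht => by
      rw [Set.uIcc_of_le hd.le] at ht
      exact Real.sin_pos_of_pos_of_lt_pi (by linarith [ht.2]) (by linarith [ht.1])
    have hcongr : ∫ t in 0..d, coneNorm Ω (γ t) (deriv (fun s => (γ s : Amb n)) t) =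
        ∫ t in 0..d, Real.cos (τ - t) / Real.sin (τ - t) := by
      refine intervalIntegral.integral_congr fun t ht => ?_
      rw [Set.uIcc_of_le hd.le] at ht
      simp only [hγ, (hasDerivAt_geod (x : Amb n) θ t).deriv]
      exact coneNorm_geod hb hbeq (by linarith [ht.2]) (by linarith [ht.1])
        (hmem t ht.1 (ht.2.trans_lt hdτ)) hu hub
    rw [hcongr, intervalIntegral.integral_eq_sub_of_hasDerivAt
      (f := fun t => -Real.log (Real.sin (τ - t)))]
    · have h0 := hsin 0 Set.left_mem_uIcc
      have h1 := hsin d Set.right_mem_uIcc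
      rw [sub_zero] at h0 ⊢
      rw [Real.log_div h0.ne' h1.ne']
      ring
    · intro t ht
      have h1 := (((hasDerivAt_id t).const_sub τ).sin.log (hsin t ht).ne').neg
      refine h1.congr_deriv ?_
      simp [neg_div]
    · refine ContinuousOn.intervalIntegrable ?_
      exact ContinuousOn.div (by fun_prop) (by fun_prop) fun t ht => (hsin t ht).ne'

/-! ### The Finsler distance -/

lemma isGLB_lengths (hn : 1 ≤ n) {Ω : Set (Sph n)} (hopen : IsOpen Ω) (hconv : SphConvex Ω)
    {p : Sph n → Amb n → ℝ} (hp : ∀ x ∈ Ω, ∀ ξ ∈ tangent x, p x ξ = coneNorm Ω x ξ)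
    {x y : Sph n} (hx : x ∈ Ω) (hy : y ∈ Ω) : IsGLB (lengths p Ω x y) (funk Ω x y) := by
  have hspeed : ∀ {γ : ℝ → Sph n} {a b : ℝ}, IsCurve Ω γ a b x y →
      ∫ t in a..b, speed p γ t =
        ∫ t in a..b, coneNorm Ω (γ t) (deriv (fun s => (γ s : Amb n)) t) := by
    intro γ a b hγ
    refine intervalIntegral.integral_congr fun t ht => ?_
    rw [Set.uIcc_of_le hγ.lt.le] at ht
    exact hp _ (hγ.mem t ht) _ (deriv_mem_tangent γ t)
  refine IsLeast.isGLB ⟨?_, ?_⟩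
  · rcases eq_or_ne x y with rfl | hxy
    · have hγ : IsCurve Ω (fun _ => x) 0 1 x x := ⟨one_pos, rfl, rfl, fun _ _ => hx,
        continuousOn_const, ∅, fun _ _ _ _ _ _ => contDiffOn_const⟩
      refine ⟨fun _ => x, 0, 1, hγ, ?_⟩
      rw [hspeed hγ]
      simp [funk, coneNorm_zero]
    · obtain ⟨γ, a, b, hγ, h⟩ := exists_curve_length_eq_funk hopen hconv hx hy hxy
      exact ⟨γ, a, b, hγ, by rw [h, hspeed hγ]⟩
  · rintro _ ⟨γ, a, b, hγ, rfl⟩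
    rw [hspeed hγ]
    rcases eq_or_ne x y with rfl | hxy
    -- For closed curves any support vector gives the bound log 1 = 0, although the functional
    -- itself may be negative.
    · obtain ⟨u, hu⟩ := supportVectors_nonempty hn hopen hconv hx
      have := hγ.log_le_integral hopen hu
      rw [div_self (hu.2.1 x hx).ne', Real.log_one] at this
      simpa [funk] using this
    · obtain ⟨u, hu, h⟩ := funk_eq_log hopen hconv hx hy hxy
      rw [h]
      exact hγ.log_le_integral hopen hu

end SphFunk

end

theorem mainTheorem11 (n : ℕ) (hn : 1 ≤ n) (Ω : Set (Sph n)) (hopen : IsOpen Ω)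
    (hconv : SphConvex Ω) (hdiam : DiamLtPiDivTwo Ω) :
    -- the points `b(x, y)` and `T(x, ξ, P)` exist, so that the definitions make sense
    (∀ x ∈ Ω, ∀ y ∈ Ω, x ≠ y → ∃ z ∈ frontier Ω, (z : Amb n) = bdryPoint Ω x y) ∧
    (∀ x ∈ Ω, ∀ ξ ∈ tangent x, ξ ≠ 0 → ∀ P ∈ supporting Ω,
      ∃ z ∈ P, (z : Amb n) = firstPoint P x ξ) ∧
    -- the two suprema are suprema of non-empty bounded sets and agree
    (∀ x ∈ Ω, ∀ ξ ∈ tangent x, (supporting Ω).Nonempty ∧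
      BddAbove (Set.range fun P : supporting Ω => term₁ (P : Set (Sph n)) x ξ) ∧
      BddAbove (Set.range fun P : supporting Ω => term₂ (P : Set (Sph n)) x ξ) ∧
      mink₁ Ω x ξ = mink₂ Ω x ξ) ∧
    -- they define a weak norm on each tangent space
    (∀ x ∈ Ω, mink₂ Ω x 0 = 0 ∧ ConvexOn ℝ (tangent x : Set (Amb n)) (mink₂ Ω x)) ∧
    -- every curve has a length
    (∀ x ∈ Ω, ∀ y ∈ Ω, ∀ (γ : ℝ → Sph n) (a b : ℝ), IsCurve Ω γ a b x y →
      IntervalIntegrable (speed (mink₁ Ω) γ) MeasureTheory.volume a b ∧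
      IntervalIntegrable (speed (mink₂ Ω) γ) MeasureTheory.volume a b) ∧
    -- the Finsler distance is the Funk metric
    (∀ x ∈ Ω, ∀ y ∈ Ω, IsGLB (lengths (mink₁ Ω) Ω x y) (funk Ω x y) ∧
      IsGLB (lengths (mink₂ Ω) Ω x y) (funk Ω x y)) := by
  have hinteg : ∀ {p : Sph n → Amb n → ℝ},
      (∀ x ∈ Ω, ∀ ξ ∈ tangent x, p x ξ = coneNorm Ω x ξ) → ∀ {x y γ a b}, x ∈ Ω →
      IsCurve Ω γ a b x y → IntervalIntegrable (speed p γ) MeasureTheory.volume a b := by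
    intro p hp x y γ a b hx hγ
    refine (hγ.intervalIntegrable_coneNorm hopen
      (supportVectors_nonempty hn hopen hconv hx)).congr_uIoo fun t ht => ?_
    rw [Set.uIoo_of_le hγ.lt.le] at ht
    exact (hp _ (hγ.mem t (Set.Ioo_subset_Icc_self ht)) _ (deriv_mem_tangent γ t)).symm
  have h₁ : ∀ x ∈ Ω, ∀ ξ ∈ tangent x, mink₁ Ω x ξ = coneNorm Ω x ξ := fun _ hx _ hξ =>
    mink₁_eq hx hξ
  have h₂ : ∀ x ∈ Ω, ∀ ξ ∈ tangent x, mink₂ Ω x ξ = coneNorm Ω x ξ := fun _ hx _ hξ =>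
    mink₂_eq hdiam hx hξ
  refine ⟨?_, ?_, ?_, ?_, fun x hx y _ γ a b hγ => ⟨hinteg h₁ hx hγ, hinteg h₂ hx hγ⟩,
    fun x hx y hy => ⟨isGLB_lengths hn hopen hconv h₁ hx hy,
      isGLB_lengths hn hopen hconv h₂ hx hy⟩⟩
  · intro x hx y hy hxy
    obtain ⟨θ, d, τ, b, -, -, -, -, -, -, -, hb, hbeq, -, hbd⟩ :=
      exists_geod_data hopen hconv hx hy hxy
    exact ⟨b, hb, by rw [hbeq, hbd]⟩
  · intro x hx ξ hξ h0 P hP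
    obtain ⟨u, hu, rfl⟩ := mem_supporting_iff.1 hP
    exact firstPoint_mem_hyperplane (hu.2.1 x hx) hξ h0
  · intro x hx ξ hξ
    obtain ⟨u, hu⟩ := supportVectors_nonempty hn hopen hconv hx
    obtain ⟨m, hm, h⟩ := exists_pos_le_inner hopen hx
    refine ⟨⟨_, mem_supporting_iff.2 ⟨u, hu, rfl⟩⟩, ?_, ?_, by rw [h₁ x hx ξ hξ, h₂ x hx ξ hξ]⟩
    · rw [range_term₁ hx hξ]
      exact bddAbove_coneNorm hm h ξ
    · rw [range_term₂ hdiam hx hξ]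
      exact bddAbove_coneNorm hm h ξ
  · intro x hx
    obtain ⟨m, hm, h⟩ := exists_pos_le_inner hopen hx
    refine ⟨by rw [h₂ x hx 0 (Submodule.zero_mem _), coneNorm_zero], ?_⟩
    exact (coneNorm_convexOn (supportVectors_nonempty hn hopen hconv hx) hm h
      (tangent x).convex).congr fun ξ hξ => (h₂ x hx ξ hξ).symm
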